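/- Let $G$ be a finite group acting on finite sets $X$ and $Y$, with $Y\neq\emptyset$, and let $\mathbb R^X,\mathbb R^Y$ be the permutation representations ($g\,e_x=e_{gx}$). Let $G$ act trivially on $\mathbb R$, and let $\sigma:\mathbb R\to\mathbb R$ be continuous and not a polynomial; $\sigma$ is applied coordinatewise to vectors. For representations $V,W$ of $G$, a *layer space* is a set $\{v\mapsto\varphi(v)+w \mid \varphi\in L,\ w\in W^G\}$ of affine maps $V\to W$, where $L$ is a linear subspace of $\mathrm{Hom}_G(V,W)$ and $W^G$ is the space of fixed vectors (for $W=\mathbb R^Y$, the span of the indicators of the orbits of $Y$); $L$ is its *linear part*. Let $M$ be a layer space from $\mathbb R^X$ to $\mathbb R^Y$ and $N$ a layer space from $\mathbb R^Y$ to $\mathbb R$, such that * the linear part of $M$ is compatible with the orbit decomposition of $Y$: if $\varphi$ belongs to it and $O\subseteq Y$ is an orbit, then so does the map obtained from $\varphi$ by setting the coordinates outside $O$ to $0$ (automatic if $Y$ is a single orbit, or if $M=\mathrm{Aff}_G(\mathbb R^X,\mathbb R^Y)$, the space of all $G$-equivariant affine maps); * for each orbit $O\subseteq Y$ some element $\psi$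 of the linear part of $N$ satisfies $\psi(\mathbf 1_O)\ne0$ (for instance, when $v\mapsto\sum_{i\in Y}v_i$ is in the linear part of $N$). For $h\in\mathbb N$ let $M_h=\{x\mapsto(f_1(x),\dots,f_h(x)) \mid f_k\in M\}$ and ${}_hN=\{(x_1,\dots,x_h)\mapsto g_1(x_1)+\dots+g_h(x_h)\mid g_k\in N\}$, and let the *universality class* $\mathcal U(M,N)$ be the closure of $$\bigcup_{h\in\mathbb N}\{\beta\circ\sigma\circ\alpha\mid \alpha\in M_h,\ \beta\in{}_hN\}$$ in $\mathcal C(\mathbb R^X,\mathbb R)$ with the topology of uniform convergence on compact sets. Let $\phi^1,\dots,\phi^m$ be any basis of the linear part of $M$, and for $i\in Y$ let $\phi_i:\mathbb R^X\to\mathbb R^m$, $\phi_i(x)=(\phi^1_i(x),\dots,\phi^m_i(x))$, be the associated basis maps. Then $$\mathcal U(M,N)=\overline{\Delta},\qquad \Delta=\Big\{x\mapsto\sum_{i\in Y}f(\phi_i(x)) \;\Big|\; f\in\mathcal C(\mathbb R^m,\mathbb R)\Big\},$$ where the closure is taken in the same topology. -/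

import Mathlib

noncomputable section

namespace InvNet

/-- The permutation representation of `G` on `ℝ^X`: the linear action with `g e_x = e_{g x}`,
that is `(g v)(x) = v (g⁻¹ x)`. -/
def permRep (G X : Type*) [Group G] [MulAction G X] : Representation ℝ G (X → ℝ) where
  toFun g := LinearMap.funLeft ℝ ℝ (fun x => g⁻¹ • x)
  map_one' := by
    ext v x
    simp [LinearMap.funLeft]
  map_mul' g h := by
    ext v x
    simp [LinearMap.funLeft, mul_smul]

lemma permRep_apply {G X : Type*} [Group G] [MulAction G X] (g : G) (v : X → ℝ) (x : X) :
    permRep G X g v x = v (g⁻¹ • x) := rfl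

/-- The defining property of the permutation representation on the canonical basis. -/
lemma permRep_single {G X : Type*} [Group G] [MulAction G X] [DecidableEq X] (g : G) (x : X) :
    permRep G X g (Pi.single x 1) = Pi.single (g • x) 1 := by
  ext y
  simp only [permRep_apply, Pi.single_apply, inv_smul_eq_iff]

/-- The fixed vectors of `ℝ^Y` are the linear combinations of the indicators of the orbits. -/
lemma mem_invariants_permRep {G Y : Type*} [Group G] [MulAction G Y] (w : Y → ℝ) :
    w ∈ (permRep G Y).invariants ↔
      ∃ c : MulAction.orbitRel.Quotient G Y → ℝ, ∀ y, w y = c (Quotient.mk _ y) := by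
  rw [Representation.mem_invariants]
  constructor
  · intro h
    refine ⟨Quotient.lift w ?_, fun y => rfl⟩
    rintro a b ⟨g, hg⟩
    have := congrFun (h g) a
    rw [permRep_apply, ← hg] at this
    simpa [← hg] using this.symm
  · rintro ⟨c, hc⟩ g
    ext y
    rw [permRep_apply, hc, hc]
    congr 1
    exact Quotient.sound ⟨g⁻¹, rfl⟩

section layers

variable {G V W : Type*} [Group G] [AddCommGroup V] [Module ℝ V] [AddCommGroup W] [Module ℝ W]

/-- `M` is a layer space of equivariant affine maps `V → W`:
`M = {v ↦ φ v + w | φ ∈ L, w ∈ W^G}` for a linear subspace `L` of `Hom_G(V, W)`. -/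
def IsLayerSpace (ρ : Representation ℝ G V) (τ : Representation ℝ G W)
    (M : Submodule ℝ (V →ᵃ[ℝ] W)) : Prop :=
  ∃ L : Submodule ℝ (V →ₗ[ℝ] W),
    (∀ φ ∈ L, ∀ g v, φ (ρ g v) = τ g (φ v)) ∧
    ∀ f : V →ᵃ[ℝ] W, f ∈ M ↔ ∃ φ ∈ L, ∃ w ∈ τ.invariants, ∀ v, f v = φ v + w

/-- The space `λ(M)` of linear parts of the affine maps in `M`. -/
def linearPart (M : Submodule ℝ (V →ᵃ[ℝ] W)) : Submodule ℝ (V →ₗ[ℝ] W) :=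
  M.map (LinearMap.snd ℝ W (V →ₗ[ℝ] W) ∘ₗ
    (AffineMap.toConstProdLinearMap ℝ : (V →ᵃ[ℝ] W) ≃ₗ[ℝ] W × (V →ₗ[ℝ] W)).toLinearMap)

lemma mem_linearPart (M : Submodule ℝ (V →ᵃ[ℝ] W)) (φ : V →ₗ[ℝ] W) :
    φ ∈ linearPart M ↔ ∃ f ∈ M, f.linear = φ := Iff.rfl

end layers

/-- The projection of `ℝ^Y` onto the coordinates in the orbit of `y`; the other coordinates are
set to zero. -/
def orbitProj (G : Type*) {Y : Type*} [Group G] [MulAction G Y] (y : Y) :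
    (Y → ℝ) →ₗ[ℝ] (Y → ℝ) where
  toFun v := (MulAction.orbit G y).indicator v
  map_add' v w := Set.indicator_add _ v w
  map_smul' c v := Set.indicator_const_smul _ c v

section networks

variable {V Y Z : Type*} [AddCommGroup V] [Module ℝ V] [AddCommGroup Z] [Module ℝ Z]

/-- The point-wise activation on `ℝ^I`. -/
def pointwise {I : Type*} (σ : ℝ → ℝ) (v : I → ℝ) : I → ℝ := fun i => σ (v i)

/-- The neural space of shallow networks `x ↦ φ (σ (η x))` with layers `η ∈ A`, `φ ∈ B`. -/
def neuralSpace {I : Type*} (σ : ℝ → ℝ) (A : Set (V →ᵃ[ℝ] (I → ℝ)))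
    (B : Set ((I → ℝ) →ᵃ[ℝ] Z)) : Set (V → Z) :=
  {F | ∃ η ∈ A, ∃ φ ∈ B, F = fun x => φ (pointwise σ (η x))}

/-- `M_h = {x ↦ (f_1 x, …, f_h x) | f_k ∈ M}`; the hidden space `ℝ^Y ⊗ ℝ^h` is
`ℝ^([h] × Y)`. -/
def widen (M : Submodule ℝ (V →ᵃ[ℝ] (Y → ℝ))) (h : ℕ) : Set (V →ᵃ[ℝ] (Fin h × Y → ℝ)) :=
  {F | ∃ f : Fin h → (V →ᵃ[ℝ] (Y → ℝ)), (∀ k, f k ∈ M) ∧ ∀ x k y, F x (k, y) = f k x y}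

/-- `_hN = {(x_1, …, x_h) ↦ g_1 x_1 + ⋯ + g_h x_h | g_k ∈ N}`. -/
def cowiden (N : Submodule ℝ ((Y → ℝ) →ᵃ[ℝ] Z)) (h : ℕ) : Set ((Fin h × Y → ℝ) →ᵃ[ℝ] Z) :=
  {F | ∃ g : Fin h → ((Y → ℝ) →ᵃ[ℝ] Z), (∀ k, g k ∈ N) ∧
    ∀ v, F v = ∑ k, g k (fun y => v (k, y))}

/-- The universality class `U(M, N)`: the closure in `C(V, Z)`, for uniform convergence on compact
sets (the compact-open topology), of the networks of all widths. -/
def universalityClass [TopologicalSpace V] [TopologicalSpace Z] (σ : ℝ → ℝ)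
    (M : Submodule ℝ (V →ᵃ[ℝ] (Y → ℝ))) (N : Submodule ℝ ((Y → ℝ) →ᵃ[ℝ] Z)) : Set C(V, Z) :=
  closure {F | ∃ h : ℕ, ⇑F ∈ neuralSpace σ (widen M h) (cowiden N h)}

end networks

/-- The basis map `φ_i : x ↦ (φ^1_i(x), …, φ^m_i(x))` of linear maps `φ^1, …, φ^m : V → ℝ^Y`. -/
def basisMap {V Y : Type*} [AddCommGroup V] [Module ℝ V] {m : ℕ}
    (φ : Fin m → (V →ₗ[ℝ] (Y → ℝ))) (i : Y) : V →ₗ[ℝ] (Fin m → ℝ) :=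
  LinearMap.pi fun t => LinearMap.proj i ∘ₗ φ t

/-- The symmetric ridge superpositions `Δ(φ_i)_{i ∈ Y}`. -/
def symmetricSuperpositions {V Y : Type*} [AddCommGroup V] [Module ℝ V] [TopologicalSpace V]
    [Fintype Y] {m : ℕ} (φ : Y → (V →ₗ[ℝ] (Fin m → ℝ))) : Set C(V, ℝ) :=
  {F | ∃ f : C(Fin m → ℝ, ℝ), ∀ x, F x = ∑ i, f (φ i x)}

end InvNet

end

/-!
The closure of the networks is a closed linear subspace of `C(V, ℝ)`. Orbit compatibility of the
hidden layer and the invariance of the readouts place every function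
`x ↦ ∑ i ∈ O, σ (ℓ (φ_i x) + b)` with `O` an orbit in it. Pulling this subspace back along
`f ↦ ∑ i ∈ O, f ∘ φ_i` therefore gives a closed subspace of `C(ℝ^m, ℝ)` containing all ridge
functions with profile `σ`, and such a subspace is everything (Leshno, Lin, Pinkus and Schocken).
Indeed the profiles whose ridge functions all lie in the subspace form a closed, affinely invariant
space on the line. Mollifying `σ` and differentiating in the weight produces the monomial of degree
`n`, unless the `n`-th derivatives of all mollifications vanish; but then `σ`, a pointwise limit of
polynomials of degree less than `n`, would be a polynomial. Hence every profile occurs, in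
particular `exp`, and the exponentials span a point-separating algebra.

Conversely, a network is a sum over `i` of functions of `φ_i x` that may depend on the orbit of `i`.
Read in the coordinates of the basis, the orbit projections are linear endomorphisms of `ℝ^m` that
recognise the orbit from `φ_i x`, up to values at `0`, so that one common outer function suffices.
-/

namespace InvNet

open Filter Topology MeasureTheory Set
open scoped Convolution ContDiff

section compactOpen

lemma mem_closure_of_forall_restrict {X E : Type*} [TopologicalSpace X] [UniformSpace E]
    {S : Set C(X, E)} {f : C(X, E)}
    (h : ∀ K : Set X, IsCompact K → f.restrict K ∈ closure ((fun g => g.restrict K) '' S)) :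
    f ∈ closure S := by
  rw [mem_closure_iff_nhds_basis
    (nhds_basis_uniformity' ContinuousMap.hasBasis_compactConvergenceUniformity)]
  rintro ⟨K, U⟩ ⟨hK, hU⟩
  have := isCompact_iff_compactSpace.mp hK
  obtain ⟨-, ⟨g, hg, rfl⟩, hfg⟩ := (mem_closure_iff_nhds_basis (nhds_basis_uniformity'
    ContinuousMap.hasBasis_compactConvergenceUniformity_of_compact)).mp (h K hK) U hU
  exact ⟨g, hg, fun x hx => hfg ⟨x, hx⟩⟩

lemma dense_of_separatesPoints {X : Type*} [TopologicalSpace X]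
    {A : Subalgebra ℝ C(X, ℝ)} (hA : A.SeparatesPoints) : Dense (A : Set C(X, ℝ)) := by
  refine fun f => mem_closure_of_forall_restrict fun K hK => ?_
  have := isCompact_iff_compactSpace.mp hK
  refine Metric.mem_closure_iff.mpr fun ε hε => ?_
  obtain ⟨g, hg, hgf⟩ :=
    ContinuousMap.exists_mem_subalgebra_near_continuous_of_isCompact_of_separatesPoints hA f hK hε
  refine ⟨g.restrict K, ⟨g, hg, rfl⟩, (ContinuousMap.dist_lt_iff hε).mpr fun x => ?_⟩
  rw [dist_comm, Real.dist_eq]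
  exact hgf x x.2

lemma eq_top_of_dense_subset {E : Type*} [AddCommGroup E] [Module ℝ E] [TopologicalSpace E]
    {S : Submodule ℝ E} (hS : IsClosed (S : Set E)) {s : Set E} (hs : Dense s) (hsS : s ⊆ S) :
    S = ⊤ :=
  SetLike.coe_injective <| hS.closure_eq.symm.trans (hs.mono hsS).closure_eq

variable {X E : Type*} [TopologicalSpace X] [NormedAddCommGroup E] [NormedSpace ℝ E]
  {S : Submodule ℝ C(X, E)}

/-- Restriction of continuous functions to a set, as a linear map. -/
def restrictₗ (E : Type*) [NormedAddCommGroup E] [NormedSpace ℝ E] (K : Set X) :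
    C(X, E) →ₗ[ℝ] C(K, E) where
  toFun f := f.restrict K
  map_add' _ _ := rfl
  map_smul' _ _ := rfl

lemma mem_of_forall_restrict_mem (hS : IsClosed (S : Set C(X, E))) {f : C(X, E)}
    (h : ∀ K : Set X, IsCompact K → f.restrict K ∈ (S.map (restrictₗ E K)).topologicalClosure) :
    f ∈ S :=
  hS.closure_subset <| mem_closure_of_forall_restrict h

lemma integral_mem_of_isClosed {α F : Type*} [MeasurableSpace α] {μ : Measure α}
    [NormedAddCommGroup F] [NormedSpace ℝ F] [CompleteSpace F] {T : Submodule ℝ F}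
    (hT : IsClosed (T : Set F)) {γ : α → F} (hγ : ∀ s, γ s ∈ T) : ∫ s, γ s ∂μ ∈ T := by
  have := hT.completeSpace_coe
  lift γ to α → T using hγ
  exact T.subtypeₗᵢ.integral_comp_comm γ ▸ (∫ s, γ s ∂μ).2

lemma mem_of_eq_integral [CompleteSpace E] {α : Type*} [TopologicalSpace α] [MeasurableSpace α]
    [OpensMeasurableSpace α] {μ : Measure α} [IsFiniteMeasureOnCompacts μ]
    (hS : IsClosed (S : Set C(X, E))) {γ : α → C(X, E)} (hγ : Continuous γ)
    (hγ' : HasCompactSupport γ) (hγS : ∀ s, γ s ∈ S) {f : C(X, E)}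
    (hf : ∀ x, f x = ∫ s, γ s x ∂μ) : f ∈ S := by
  refine mem_of_forall_restrict_mem hS fun K hK => ?_
  have := isCompact_iff_compactSpace.mp hK
  have hint : Integrable (fun s => (γ s).restrict K) μ :=
    ((ContinuousMap.continuous_restrict K).comp hγ).integrable_of_hasCompactSupport
      (hγ'.comp_left (g := ContinuousMap.restrict K) rfl)
  have hfK : f.restrict K = ∫ s, (γ s).restrict K ∂μ := by
    ext x
    rw [ContinuousMap.integral_apply hint]
    exact hf x
  rw [hfK]
  exact integral_mem_of_isClosed (Submodule.isClosed_topologicalClosure _) fun s =>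
    Submodule.le_topologicalClosure _ ⟨γ s, hγS s, rfl⟩

lemma hasDerivAt_of_forall_hasDerivAt_apply [CompleteSpace E] [CompactSpace X] {γ γ' : ℝ → C(X, E)}
    (hγ' : Continuous γ') (h : ∀ s x, HasDerivAt (fun r => γ r x) (γ' s x) s) (s : ℝ) :
    HasDerivAt γ (γ' s) s := by
  have hγ : γ = fun r => γ 0 + ∫ u in (0 : ℝ)..r, γ' u := by
    ext r x
    have hint : ∫ u in (0 : ℝ)..r, γ' u x = (∫ u in (0 : ℝ)..r, γ' u) x :=
      (ContinuousMap.evalCLM ℝ x).intervalIntegral_comp_comm (hγ'.intervalIntegrable 0 r)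
    rw [ContinuousMap.add_apply, ← hint, intervalIntegral.integral_eq_sub_of_hasDerivAt
      (fun u _ => h u x) (((continuous_eval_const x).comp hγ').intervalIntegrable 0 r)]
    exact (add_sub_cancel _ _).symm
  rw [hγ]
  exact (hγ'.integral_hasStrictDerivAt 0 s).hasDerivAt.const_add _

lemma mem_of_forall_hasDerivAt_apply [CompleteSpace E] (hS : IsClosed (S : Set C(X, E)))
    {γ γ' : ℝ → C(X, E)} (hγ' : Continuous γ')
    (h : ∀ s x, HasDerivAt (fun r => γ r x) (γ' s x) s) (hγS : ∀ s, γ s ∈ S) (s : ℝ) :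
    γ' s ∈ S := by
  refine mem_of_forall_restrict_mem hS fun K hK => ?_
  have := isCompact_iff_compactSpace.mp hK
  have hderiv : HasDerivAt (fun r => (γ r).restrict K) ((γ' s).restrict K) s :=
    hasDerivAt_of_forall_hasDerivAt_apply ((ContinuousMap.continuous_restrict K).comp hγ')
      (fun r x => h r x) s
  have hspan : Submodule.span ℝ ((fun r => (γ r).restrict K) '' univ) ≤ S.map (restrictₗ E K) := by
    rw [Submodule.span_le]
    rintro - ⟨r, -, rfl⟩
    exact ⟨γ r, hγS r, rfl⟩
  exact closure_mono hspan
    (range_deriv_subset_closure_span_image _ dense_univ ⟨s, hderiv.deriv⟩)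

end compactOpen

section univariate

/-- The polynomial functions on `ℝ` of degree less than `n`. -/
noncomputable def polynomialFunctionsLT (n : ℕ) : Submodule ℝ (ℝ → ℝ) :=
  (Polynomial.degreeLT ℝ n).map (LinearMap.pi Polynomial.leval)

lemma isClosed_polynomialFunctionsLT (n : ℕ) :
    IsClosed (polynomialFunctionsLT n : Set (ℝ → ℝ)) := by
  have : FiniteDimensional ℝ (Polynomial.degreeLT ℝ n) :=
    (Polynomial.degreeLTEquiv ℝ n).symm.finiteDimensional
  exact ((Polynomial.degreeLT ℝ n).map _).closed_of_finiteDimensional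

lemma eq_sum_of_iteratedDeriv_eq_zero {n : ℕ} {g : ℝ → ℝ} (hg : ContDiff ℝ n g)
    (h : ∀ t, iteratedDeriv n g t = 0) (t : ℝ) :
    g t = ∑ k ∈ Finset.range n, iteratedDeriv k g 0 / k.factorial * t ^ k := by
  rcases n with _ | n
  · simpa using h t
  rcases eq_or_ne t 0 with rfl | ht
  · simp [Finset.sum_range_succ']
  obtain ⟨u, -, hu⟩ := taylor_mean_remainder_lagrange_iteratedDeriv ht.symm hg.contDiffOn
  rw [h, zero_mul, zero_div, sub_eq_zero, taylor_within_apply] at hu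
  rw [hu]
  refine Finset.sum_congr rfl fun k hk => ?_
  rw [iteratedDerivWithin_eq_iteratedDeriv (uniqueDiffOn_uIcc ht.symm)
    (hg.contDiffAt.of_le (by exact_mod_cast (Finset.mem_range.mp hk).le)) left_mem_uIcc,
    sub_zero, smul_eq_mul]
  ring

lemma mem_polynomialFunctionsLT_of_iteratedDeriv_eq_zero {n : ℕ} {g : ℝ → ℝ}
    (hg : ContDiff ℝ n g) (h : ∀ t, iteratedDeriv n g t = 0) : g ∈ polynomialFunctionsLT n := by
  refine ⟨∑ k ∈ Finset.range n, Polynomial.monomial k (iteratedDeriv k g 0 / k.factorial),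
    Submodule.sum_mem _ fun k hk => ?_, ?_⟩
  · exact Polynomial.mem_degreeLT.mpr ((Polynomial.degree_monomial_le _ _).trans_lt
      (by exact_mod_cast Finset.mem_range.mp hk))
  · ext t
    simp [eq_sum_of_iteratedDeriv_eq_zero hg h t]

/-- Stability of a space of functions on the line under precomposition with affine maps
`t ↦ w t + b`, including the constant ones. -/
def IsAffineInvariant (S : Submodule ℝ C(ℝ, ℝ)) : Prop :=
  ∀ g ∈ S, ∀ w b : ℝ, g.comp (w • ContinuousMap.id ℝ + ContinuousMap.const ℝ b) ∈ S

variable {S : Submodule ℝ C(ℝ, ℝ)}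

/- Differentiating `t ↦ t ^ k * f k (w * t + b)` in `w` brings down one more factor `t`. -/
lemma pow_mul_comp_mem_of_hasDerivAt (hS : IsClosed (S : Set C(ℝ, ℝ))) {f : ℕ → C(ℝ, ℝ)}
    (hf : ∀ k t, HasDerivAt (f k) (f (k + 1) t) t) {b : ℝ}
    (h : ∀ w : ℝ, (f 0).comp (w • ContinuousMap.id ℝ + ContinuousMap.const ℝ b) ∈ S)
    (k : ℕ) (w : ℝ) :
    ContinuousMap.id ℝ ^ k * (f k).comp (w • ContinuousMap.id ℝ + ContinuousMap.const ℝ b) ∈ S := by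
  induction k generalizing w with
  | zero => simpa using h w
  | succ k ih =>
    refine mem_of_forall_hasDerivAt_apply hS (γ := fun v => ContinuousMap.id ℝ ^ k *
      (f k).comp (v • ContinuousMap.id ℝ + ContinuousMap.const ℝ b))
      (γ' := fun v => ContinuousMap.id ℝ ^ (k + 1) *
        (f (k + 1)).comp (v • ContinuousMap.id ℝ + ContinuousMap.const ℝ b)) ?_ ?_ ih w
    · exact continuous_const.mul ((ContinuousMap.continuous_postcomp _).comp (by fun_prop))
    · intro v t
      have hline : HasDerivAt (fun v : ℝ => v * t + b) t v := by
        simpa using ((hasDerivAt_id v).mul_const t).add_const b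
      simpa [pow_succ, mul_assoc, mul_comm t] using ((hf k _).comp v hline).const_mul (t ^ k)

lemma iteratedDeriv_smul_id_pow_mem (hS : IsClosed (S : Set C(ℝ, ℝ))) (hS' : IsAffineInvariant S)
    {g : C(ℝ, ℝ)} (hg : g ∈ S) (hg' : ContDiff ℝ ∞ g) (n : ℕ) (b : ℝ) :
    iteratedDeriv n g b • ContinuousMap.id ℝ ^ n ∈ S := by
  have hmem := pow_mul_comp_mem_of_hasDerivAt hS (b := b)
    (f := fun k => ⟨iteratedDeriv k g, hg'.continuous_iteratedDeriv k (by exact_mod_cast le_top)⟩)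
    (fun k t => by
      simpa [iteratedDeriv_succ] using
        (hg'.differentiable_iteratedDeriv k (by exact_mod_cast ENat.natCast_lt_top k) t).hasDerivAt)
    (hS' g hg · b) n 0
  convert hmem using 1
  ext t
  simp [mul_comm]

lemma normed_convolution_mem (hS : IsClosed (S : Set C(ℝ, ℝ))) (hS' : IsAffineInvariant S)
    {g f : C(ℝ, ℝ)} (hg : g ∈ S) (φ : ContDiffBump (0 : ℝ))
    (hf : ⇑f = φ.normed volume ⋆[ContinuousLinearMap.lsmul ℝ ℝ, volume] g) : f ∈ S := by
  refine mem_of_eq_integral (μ := volume) hS (γ := fun s => φ.normed volume s •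
    g.comp ((1 : ℝ) • ContinuousMap.id ℝ + ContinuousMap.const ℝ (-s))) ?_ ?_ ?_ ?_
  · exact φ.continuous_normed.smul ((ContinuousMap.continuous_postcomp _).comp
      (continuous_const.add (ContinuousMap.continuous_const'.comp continuous_neg)))
  · exact φ.hasCompactSupport_normed.smul_right
  · exact fun s => S.smul_mem _ (hS' g hg _ _)
  · intro t
    simp [hf, convolution_def, sub_eq_add_neg]

lemma exists_contDiff_tendsto (hS : IsClosed (S : Set C(ℝ, ℝ))) (hS' : IsAffineInvariant S)
    {g : C(ℝ, ℝ)} (hg : g ∈ S) :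
    ∃ u : ℕ → C(ℝ, ℝ), (∀ j, u j ∈ S ∧ ContDiff ℝ ∞ (u j)) ∧
      Tendsto (fun j => ⇑(u j)) atTop (𝓝 g) := by
  let φ (j : ℕ) : ContDiffBump (0 : ℝ) :=
    ⟨1 / (j + 1) / 2, 1 / (j + 1), by positivity, half_lt_self (by positivity)⟩
  have hsmooth (j : ℕ) :
      ContDiff ℝ ∞ ((φ j).normed volume ⋆[ContinuousLinearMap.lsmul ℝ ℝ, volume] g) :=
    (φ j).hasCompactSupport_normed.contDiff_convolution_left _ (φ j).contDiff_normed
      g.continuous.locallyIntegrable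
  refine ⟨fun j => ⟨_, (hsmooth j).continuous⟩, fun j => ⟨?_, hsmooth j⟩, ?_⟩
  · exact normed_convolution_mem hS hS' hg (φ j) rfl
  · exact tendsto_pi_nhds.mpr <| ContDiffBump.convolution_tendsto_right_of_continuous
      tendsto_one_div_add_atTop_nhds_zero_nat g.continuous

lemma id_pow_mem_of_not_polynomial (hS : IsClosed (S : Set C(ℝ, ℝ))) (hS' : IsAffineInvariant S)
    {σ : C(ℝ, ℝ)} (hσS : σ ∈ S) (hσ : ¬ ∃ p : Polynomial ℝ, ∀ t, σ t = p.eval t) (n : ℕ) :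
    ContinuousMap.id ℝ ^ n ∈ S := by
  by_contra hn
  obtain ⟨u, hu, hlim⟩ := exists_contDiff_tendsto hS hS' hσS
  have hpoly (j : ℕ) : ⇑(u j) ∈ polynomialFunctionsLT n := by
    refine mem_polynomialFunctionsLT_of_iteratedDeriv_eq_zero
      ((hu j).2.of_le (by exact_mod_cast le_top)) fun b => ?_
    by_contra hb
    exact hn ((S.smul_mem_iff hb).mp (iteratedDeriv_smul_id_pow_mem hS hS' (hu j).1 (hu j).2 n b))
  obtain ⟨p, -, hp⟩ :=
    (isClosed_polynomialFunctionsLT n).mem_of_tendsto hlim (Eventually.of_forall hpoly)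
  exact hσ ⟨p, fun t => (congrFun hp t).symm⟩

lemma eq_top_of_isAffineInvariant (hS : IsClosed (S : Set C(ℝ, ℝ))) (hS' : IsAffineInvariant S)
    {σ : C(ℝ, ℝ)} (hσS : σ ∈ S) (hσ : ¬ ∃ p : Polynomial ℝ, ∀ t, σ t = p.eval t) : S = ⊤ := by
  let toFun : Polynomial ℝ →ₐ[ℝ] C(ℝ, ℝ) := Polynomial.toContinuousMapAlgHom
  have hsep : toFun.range.SeparatesPoints := fun x y hxy =>
    ⟨toFun Polynomial.X, ⟨_, ⟨Polynomial.X, rfl⟩, rfl⟩, by simpa [toFun] using hxy⟩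
  refine eq_top_of_dense_subset hS (dense_of_separatesPoints hsep) ?_
  rintro - ⟨p, rfl⟩
  have hp : toFun p = ∑ k ∈ p.support, p.coeff k • ContinuousMap.id ℝ ^ k := by
    ext t
    simp [toFun, Polynomial.eval_eq_sum, Polynomial.sum]
  exact hp ▸ S.sum_mem fun k _ => S.smul_mem _ (id_pow_mem_of_not_polynomial hS hS' hσS hσ k)

end univariate

section ridge

variable {E : Type*} [AddCommGroup E] [Module ℝ E] [TopologicalSpace E]

/-- The profiles `g` all of whose ridge functions `x ↦ g (ℓ x + b)` lie in `T`. -/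
def ridgeProfiles (T : Submodule ℝ C(E, ℝ)) : Submodule ℝ C(ℝ, ℝ) where
  carrier := {g | ∀ (ℓ : StrongDual ℝ E) (b : ℝ),
    g.comp ((ℓ : C(E, ℝ)) + ContinuousMap.const E b) ∈ T}
  add_mem' hf hg ℓ b := T.add_mem (hf ℓ b) (hg ℓ b)
  zero_mem' _ _ := T.zero_mem
  smul_mem' c _ hg ℓ b := T.smul_mem c (hg ℓ b)

lemma isClosed_ridgeProfiles {T : Submodule ℝ C(E, ℝ)} (hT : IsClosed (T : Set C(E, ℝ))) :
    IsClosed (ridgeProfiles T : Set C(ℝ, ℝ)) := by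
  change IsClosed {g : C(ℝ, ℝ) | ∀ (ℓ : StrongDual ℝ E) (b : ℝ),
    g.comp ((ℓ : C(E, ℝ)) + ContinuousMap.const E b) ∈ T}
  simp only [ofPred_forall]
  exact isClosed_iInter fun _ => isClosed_iInter fun _ =>
    hT.preimage (ContinuousMap.continuous_precomp _)

lemma isAffineInvariant_ridgeProfiles (T : Submodule ℝ C(E, ℝ)) :
    IsAffineInvariant (ridgeProfiles T) := by
  intro g hg w c ℓ b
  convert hg (w • ℓ) (w * b + c) using 1
  ext x
  simp [add_assoc]

/-- The exponential functions `x ↦ exp (ℓ x)`, multiplicative in the functional `ℓ`. -/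
noncomputable def expHom (E : Type*) [AddCommGroup E] [Module ℝ E] [TopologicalSpace E] :
    Multiplicative (StrongDual ℝ E) →* C(E, ℝ) where
  toFun ℓ := ContinuousMap.comp ⟨Real.exp, Real.continuous_exp⟩ (ℓ.toAdd : C(E, ℝ))
  map_one' := by
    ext x
    simp
  map_mul' ℓ ℓ' := by
    ext x
    simp [Real.exp_add]

lemma dense_span_range_expHom [SeparatingDual ℝ E] :
    Dense (Submodule.span ℝ (range (expHom E)) : Set C(E, ℝ)) := by
  have hspan : (Algebra.adjoin ℝ (range (expHom E))).toSubmodule =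
      Submodule.span ℝ (range (expHom E)) := by
    rw [Algebra.adjoin_eq_span, ← MonoidHom.coe_mrange, Submonoid.closure_eq]
  rw [← hspan]
  refine dense_of_separatesPoints fun x y hxy => ?_
  obtain ⟨ℓ, hℓ⟩ := SeparatingDual.exists_separating_of_ne (R := ℝ) hxy
  exact ⟨_, ⟨expHom E (.ofAdd ℓ), Algebra.subset_adjoin ⟨_, rfl⟩, rfl⟩,
    fun h => hℓ (Real.exp_injective h)⟩

theorem eq_top_of_forall_ridge_mem [SeparatingDual ℝ E] {T : Submodule ℝ C(E, ℝ)}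
    (hT : IsClosed (T : Set C(E, ℝ))) {σ : C(ℝ, ℝ)}
    (hσ : ¬ ∃ p : Polynomial ℝ, ∀ t, σ t = p.eval t)
    (h : ∀ (ℓ : StrongDual ℝ E) (b : ℝ),
      σ.comp ((ℓ : C(E, ℝ)) + ContinuousMap.const E b) ∈ T) : T = ⊤ := by
  have htop : ridgeProfiles T = ⊤ := eq_top_of_isAffineInvariant (isClosed_ridgeProfiles hT)
    (isAffineInvariant_ridgeProfiles T) h hσ
  refine eq_top_of_dense_subset hT dense_span_range_expHom (Submodule.span_le.mpr ?_)
  rintro - ⟨ℓ, rfl⟩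
  have hexp : ⟨Real.exp, Real.continuous_exp⟩ ∈ ridgeProfiles T := htop ▸ Submodule.mem_top
  simpa [expHom] using hexp ℓ.toAdd 0

end ridge

section layers

variable {G V W : Type*} [Group G] [AddCommGroup V] [Module ℝ V] [AddCommGroup W] [Module ℝ W]
  {ρ : Representation ℝ G V} {τ : Representation ℝ G W} {M : Submodule ℝ (V →ᵃ[ℝ] W)}

lemma linear_eq_of_forall_eq_add {f : V →ᵃ[ℝ] W} {φ : V →ₗ[ℝ] W} {w : W}
    (h : ∀ v, f v = φ v + w) : f.linear = φ := by
  ext v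
  have hv : f v = f.linear v + f 0 := congrFun f.decomp v
  rwa [h, h, map_zero, zero_add, add_left_inj, eq_comm] at hv

lemma IsLayerSpace.mem_iff (hM : IsLayerSpace ρ τ M) (f : V →ᵃ[ℝ] W) :
    f ∈ M ↔ f.linear ∈ linearPart M ∧ f 0 ∈ τ.invariants := by
  obtain ⟨L, -, hL⟩ := hM
  constructor
  · intro hf
    obtain ⟨φ, -, w, hw, h⟩ := (hL f).mp hf
    exact ⟨⟨f, hf, rfl⟩, by simpa [h] using hw⟩
  · rintro ⟨hf, hw⟩
    obtain ⟨f', hf', hlinear⟩ := (mem_linearPart M _).mp hf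
    obtain ⟨φ, hφ, w, -, h⟩ := (hL f').mp hf'
    refine (hL f).mpr ⟨φ, hφ, f 0, hw, fun v => ?_⟩
    rw [← linear_eq_of_forall_eq_add h, hlinear]
    exact congrFun f.decomp v

lemma IsLayerSpace.map_apply (hM : IsLayerSpace ρ τ M) {φ : V →ₗ[ℝ] W} (hφ : φ ∈ linearPart M)
    (g : G) (v : V) : φ (ρ g v) = τ g (φ v) := by
  obtain ⟨L, hLG, hL⟩ := hM
  obtain ⟨f, hf, rfl⟩ := (mem_linearPart M _).mp hφ
  obtain ⟨φ, hφ, w, -, h⟩ := (hL f).mp hf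
  rw [linear_eq_of_forall_eq_add h]
  exact hLG φ hφ g v

lemma IsLayerSpace.add_const_mem (hM : IsLayerSpace ρ τ M) {φ : V →ₗ[ℝ] W}
    (hφ : φ ∈ linearPart M) {w : W} (hw : w ∈ τ.invariants) :
    φ.toAffineMap + AffineMap.const ℝ V w ∈ M :=
  (hM.mem_iff _).mpr ⟨by simpa using hφ, by simpa using hw⟩

end layers

section orbits

variable {G Y : Type*} [Group G] [MulAction G Y]

/-- The class of `y` in the orbit space, in the form used by `mem_invariants_permRep`. -/
abbrev orbitOf (G : Type*) {Y : Type*} [Group G] [MulAction G Y] (y : Y) :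
    MulAction.orbitRel.Quotient G Y :=
  Quotient.mk _ y

lemma mem_orbit_iff_orbitOf_eq {i y : Y} :
    i ∈ MulAction.orbit G y ↔ orbitOf G i = orbitOf G y := by
  rw [Quotient.eq, MulAction.orbitRel_apply]

lemma exists_weights_of_invariant [Fintype Y] {ψ : (Y → ℝ) →ₗ[ℝ] ℝ}
    (hψ : ∀ g v, ψ (permRep G Y g v) = ψ v) :
    ∃ d : MulAction.orbitRel.Quotient G Y → ℝ, ∀ v, ψ v = ∑ i, d (orbitOf G i) * v i := by
  classical
  have hinv : (fun y => ψ (Pi.single y 1)) ∈ (permRep G Y).invariants := by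
    rw [Representation.mem_invariants]
    intro g
    ext y
    rw [permRep_apply, ← permRep_single, hψ]
  obtain ⟨d, hd⟩ := (mem_invariants_permRep _).mp hinv
  refine ⟨d, fun v => ?_⟩
  conv_lhs => rw [pi_eq_sum_univ' v]
  simp [← hd, mul_comm]

variable {N : Submodule ℝ ((Y → ℝ) →ᵃ[ℝ] ℝ)}

lemma IsLayerSpace.exists_eq_sum_add [Fintype Y]
    (hN : IsLayerSpace (permRep G Y) (Representation.trivial ℝ G ℝ) N) {g : (Y → ℝ) →ᵃ[ℝ] ℝ}
    (hg : g ∈ N) : ∃ d : MulAction.orbitRel.Quotient G Y → ℝ,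
      ∀ v, g v = ∑ i, d (orbitOf G i) * v i + g 0 := by
  obtain ⟨d, hd⟩ := exists_weights_of_invariant (hN.map_apply ((hN.mem_iff g).mp hg).1)
  exact ⟨d, fun v => by rw [← hd]; exact congrFun g.decomp v⟩

/- Constant values off the orbit only contribute a constant, which the bias of `g` cancels. -/
lemma IsLayerSpace.exists_mem_eq_sum_orbit [Finite Y]
    (hN : IsLayerSpace (permRep G Y) (Representation.trivial ℝ G ℝ) N) {y : Y}
    {ψ : (Y → ℝ) →ₗ[ℝ] ℝ} (hψ : ψ ∈ linearPart N) (hψy : ψ ((MulAction.orbit G y).indicator 1) ≠ 0)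
    {s : Finset Y} (hs : ↑s = MulAction.orbit G y) (c : ℝ) :
    ∃ g ∈ N, ∀ v : Y → ℝ, (∀ i ∉ s, v i = c) → g v = ∑ i ∈ s, v i := by
  have := Fintype.ofFinite Y
  obtain ⟨d, hd⟩ := exists_weights_of_invariant (hN.map_apply hψ)
  have hsum (v : Y → ℝ) :
      ψ ((s : Set Y).indicator v) = d (orbitOf G y) * ∑ i ∈ s, v i := by
    rw [hd, Finset.mul_sum, ← Finset.sum_subset s.subset_univ]
    · refine Finset.sum_congr rfl fun i hi => ?_
      have hiy : i ∈ MulAction.orbit G y := hs ▸ hi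
      rw [indicator_of_mem (by exact_mod_cast hi), mem_orbit_iff_orbitOf_eq.mp hiy]
    · intro i _ hi
      rw [indicator_of_notMem (by exact_mod_cast hi), mul_zero]
  have hdy : d (orbitOf G y) ≠ 0 := fun h => hψy <| by rw [← hs, hsum, h, zero_mul]
  refine ⟨_, N.smul_mem (d (orbitOf G y))⁻¹ (hN.add_const_mem hψ
    (w := -ψ ((s : Set Y)ᶜ.indicator fun _ => c)) (by simp [Representation.mem_invariants])),
    fun v hv => ?_⟩
  have hcompl : (s : Set Y)ᶜ.indicator v = (s : Set Y)ᶜ.indicator fun _ => c :=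
    indicator_congr fun i hi => hv i hi
  have hψv : ψ v = d (orbitOf G y) * ∑ i ∈ s, v i + ψ ((s : Set Y)ᶜ.indicator fun _ => c) := by
    rw [← hsum, ← hcompl, ← map_add, indicator_self_add_compl]
  simp [hψv, mul_add, inv_mul_cancel_left₀ hdy]

end orbits

section networks

variable {V Y : Type*} [AddCommGroup V] [Module ℝ V]

lemma mem_neuralSpace_widen {Z : Type*} [AddCommGroup Z] [Module ℝ Z] {σ : ℝ → ℝ}
    {M : Submodule ℝ (V →ᵃ[ℝ] (Y → ℝ))} {N : Submodule ℝ ((Y → ℝ) →ᵃ[ℝ] Z)} {h : ℕ} {F : V → Z} :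
    F ∈ neuralSpace σ (widen M h) (cowiden N h) ↔
      ∃ f : Fin h → (V →ᵃ[ℝ] (Y → ℝ)), ∃ g : Fin h → ((Y → ℝ) →ᵃ[ℝ] Z),
        (∀ k, f k ∈ M) ∧ (∀ k, g k ∈ N) ∧ ∀ x, F x = ∑ k, g k (pointwise σ (f k x)) := by
  constructor
  · rintro ⟨η, ⟨f, hf, hη⟩, β, ⟨g, hg, hβ⟩, rfl⟩
    refine ⟨f, g, hf, hg, fun x => ?_⟩
    simp only [hβ, pointwise, hη]
    rfl
  · rintro ⟨f, g, hf, hg, hF⟩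
    let η : V →ᵃ[ℝ] (Fin h × Y → ℝ) :=
      AffineMap.pi fun p => (LinearMap.proj p.2).toAffineMap.comp (f p.1)
    let β : (Fin h × Y → ℝ) →ᵃ[ℝ] Z :=
      ∑ k, (g k).comp (LinearMap.funLeft ℝ ℝ fun y => (k, y)).toAffineMap
    have hβ (v : Fin h × Y → ℝ) : β v = ∑ k, g k fun y => v (k, y) := by
      let eval : ((Fin h × Y → ℝ) →ᵃ[ℝ] Z) →+ Z := ⟨⟨fun γ => γ v, rfl⟩, fun _ _ => rfl⟩
      exact map_sum eval _ _
    refine ⟨η, ⟨f, hf, fun _ _ _ => rfl⟩, β, ⟨g, hg, hβ⟩, funext fun x => ?_⟩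
    rw [hF, hβ]
    rfl

variable [TopologicalSpace V]

/-- The continuous networks of arbitrary width, whose closure is the universality class. -/
def networks (σ : ℝ → ℝ) (M : Submodule ℝ (V →ᵃ[ℝ] (Y → ℝ)))
    (N : Submodule ℝ ((Y → ℝ) →ᵃ[ℝ] ℝ)) : Submodule ℝ C(V, ℝ) where
  carrier := {F | ∃ h : ℕ, ⇑F ∈ neuralSpace σ (widen M h) (cowiden N h)}
  zero_mem' := ⟨0, mem_neuralSpace_widen.mpr
    ⟨fun _ => 0, fun _ => 0, fun k => k.elim0, fun k => k.elim0, fun x => by simp⟩⟩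
  add_mem' := by
    rintro F₁ F₂ ⟨h₁, H₁⟩ ⟨h₂, H₂⟩
    obtain ⟨f₁, g₁, hf₁, hg₁, hF₁⟩ := mem_neuralSpace_widen.mp H₁
    obtain ⟨f₂, g₂, hf₂, hg₂, hF₂⟩ := mem_neuralSpace_widen.mp H₂
    refine ⟨h₁ + h₂, mem_neuralSpace_widen.mpr ⟨Fin.append f₁ f₂, Fin.append g₁ g₂,
      fun k => ?_, fun k => ?_, fun x => ?_⟩⟩
    · induction k using Fin.addCases <;> simp [hf₁, hf₂]
    · induction k using Fin.addCases <;> simp [hg₁, hg₂]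
    · simp [Fin.sum_univ_add, hF₁, hF₂]
  smul_mem' := by
    rintro c F ⟨h, H⟩
    obtain ⟨f, g, hf, hg, hF⟩ := mem_neuralSpace_widen.mp H
    exact ⟨h, mem_neuralSpace_widen.mpr ⟨f, fun k => c • g k, hf,
      fun k => N.smul_mem c (hg k), fun x => by simp [hF, Finset.mul_sum]⟩⟩

variable {σ : ℝ → ℝ} {M : Submodule ℝ (V →ᵃ[ℝ] (Y → ℝ))} {N : Submodule ℝ ((Y → ℝ) →ᵃ[ℝ] ℝ)}

lemma mem_networks_of_eq {f : V →ᵃ[ℝ] (Y → ℝ)} (hf : f ∈ M) {g : (Y → ℝ) →ᵃ[ℝ] ℝ} (hg : g ∈ N)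
    {F : C(V, ℝ)} (hF : ∀ x, F x = g (pointwise σ (f x))) : F ∈ networks σ M N :=
  ⟨1, mem_neuralSpace_widen.mpr
    ⟨fun _ => f, fun _ => g, fun _ => hf, fun _ => hg, fun x => by simp [hF]⟩⟩

lemma sum_orbit_mem_networks {G : Type*} [Group G] [MulAction G Y] [Finite Y]
    {ρ : Representation ℝ G V} (hM : IsLayerSpace ρ (permRep G Y) M)
    (hN : IsLayerSpace (permRep G Y) (Representation.trivial ℝ G ℝ) N) {y : Y}
    {ψ : (Y → ℝ) →ₗ[ℝ] ℝ} (hψ : ψ ∈ linearPart N) (hψy : ψ ((MulAction.orbit G y).indicator 1) ≠ 0)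
    {s : Finset Y} (hs : ↑s = MulAction.orbit G y) {ξ : V →ₗ[ℝ] (Y → ℝ)}
    (hξ : orbitProj G y ∘ₗ ξ ∈ linearPart M) (b : ℝ) {F : C(V, ℝ)}
    (hF : ∀ x, F x = ∑ i ∈ s, σ (ξ x i + b)) : F ∈ networks σ M N := by
  have hbias : (fun _ => b) ∈ (permRep G Y).invariants :=
    (mem_invariants_permRep _).mpr ⟨fun _ => b, fun _ => rfl⟩
  obtain ⟨g, hg, hgs⟩ := hN.exists_mem_eq_sum_orbit hψ hψy hs (σ b)
  refine mem_networks_of_eq (hM.add_const_mem hξ hbias) hg fun x => ?_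
  rw [hF, hgs]
  · refine Finset.sum_congr rfl fun i hi => ?_
    have hiy : i ∈ MulAction.orbit G y := hs ▸ hi
    simp [pointwise, orbitProj, hiy]
  · intro i hi
    have hiy : i ∉ MulAction.orbit G y := hs ▸ hi
    simp [pointwise, orbitProj, hiy]

end networks

section superpositions

variable {V Y : Type*} [AddCommGroup V] [Module ℝ V] {m : ℕ}

lemma mem_span_range_iff_exists_dual {φ : Fin m → (V →ₗ[ℝ] (Y → ℝ))} {ξ : V →ₗ[ℝ] (Y → ℝ)} :
    ξ ∈ Submodule.span ℝ (range φ) ↔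
      ∃ ℓ : (Fin m → ℝ) →ₗ[ℝ] ℝ, ∀ x i, ξ x i = ℓ (basisMap φ i x) := by
  rw [Submodule.mem_span_range_iff_exists_fun]
  constructor
  · rintro ⟨c, rfl⟩
    exact ⟨Fintype.linearCombination ℝ c, fun x i => by
      simp [basisMap, Fintype.linearCombination_apply, mul_comm]⟩
  · rintro ⟨ℓ, hℓ⟩
    refine ⟨fun t => ℓ (Pi.single t 1), ?_⟩
    ext x i
    rw [hℓ, pi_eq_sum_univ' (basisMap φ i x)]
    simp [basisMap, mul_comm]

lemma IsLayerSpace.exists_eq_dual_add {G : Type*} [Group G] [MulAction G Y]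
    {ρ : Representation ℝ G V} {M : Submodule ℝ (V →ᵃ[ℝ] (Y → ℝ))}
    (hM : IsLayerSpace ρ (permRep G Y) M) {φ : Fin m → (V →ₗ[ℝ] (Y → ℝ))}
    (hφ : Submodule.span ℝ (range φ) = linearPart M) {f : V →ᵃ[ℝ] (Y → ℝ)} (hf : f ∈ M) :
    ∃ (ℓ : (Fin m → ℝ) →ₗ[ℝ] ℝ) (w : MulAction.orbitRel.Quotient G Y → ℝ),
      ∀ x i, f x i = ℓ (basisMap φ i x) + w (orbitOf G i) := by
  obtain ⟨hlinear, hzero⟩ := (hM.mem_iff f).mp hf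
  obtain ⟨ℓ, hℓ⟩ := mem_span_range_iff_exists_dual.mp (hφ ▸ hlinear)
  obtain ⟨w, hw⟩ := (mem_invariants_permRep _).mp hzero
  exact ⟨ℓ, w, fun x i => by rw [← hℓ, ← hw]; exact congrFun (congrFun f.decomp x) i⟩

lemma exists_orbit_separation {G : Type*} [Group G] [MulAction G Y]
    {φ : Fin m → (V →ₗ[ℝ] (Y → ℝ))}
    (hφ : ∀ t (y : Y), orbitProj G y ∘ₗ φ t ∈ Submodule.span ℝ (range φ)) :
    ∃ P : MulAction.orbitRel.Quotient G Y → ((Fin m → ℝ) →ₗ[ℝ] (Fin m → ℝ)),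
      (∀ i x, P (orbitOf G i) (basisMap φ i x) = basisMap φ i x) ∧
      ∀ o i x, orbitOf G i ≠ o → P o (basisMap φ i x) = 0 := by
  choose ℓ hℓ using fun (o : MulAction.orbitRel.Quotient G Y) t =>
    mem_span_range_iff_exists_dual.mp (hφ t o.out)
  have hmem (i : Y) (o : MulAction.orbitRel.Quotient G Y) :
      i ∈ MulAction.orbit G o.out ↔ orbitOf G i = o := by
    rw [mem_orbit_iff_orbitOf_eq, orbitOf.eq_def G o.out, Quotient.out_eq]
  refine ⟨fun o => LinearMap.pi (ℓ o), fun i x => ?_, fun o i x ho => ?_⟩ <;> ext t <;>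
    rw [LinearMap.pi_apply, ← hℓ]
  · exact indicator_of_mem ((hmem i _).mpr rfl) _
  · exact indicator_of_notMem (mt (hmem i o).mp ho) _

variable [TopologicalSpace V]

/-- The superposition operator `f ↦ ∑ i ∈ s, f ∘ β i`. -/
noncomputable def superposition {E : Type*} [TopologicalSpace E] (s : Finset Y) (β : Y → C(V, E)) :
    C(E, ℝ) →L[ℝ] C(V, ℝ) where
  toFun f := ∑ i ∈ s, f.comp (β i)
  map_add' f g := by simp [ContinuousMap.add_comp, Finset.sum_add_distrib]
  map_smul' c f := by simp [ContinuousMap.smul_comp, Finset.smul_sum]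
  cont := continuous_finsetSum _ fun i _ => ContinuousMap.continuous_precomp (β i)

lemma superposition_orbit_mem_closure_networks {G : Type*} [Group G] [MulAction G Y] [Finite Y]
    {σ : ℝ → ℝ} (hσ : Continuous σ) (hσ_poly : ¬ ∃ p : Polynomial ℝ, ∀ t, σ t = p.eval t)
    {ρ : Representation ℝ G V} {M : Submodule ℝ (V →ᵃ[ℝ] (Y → ℝ))}
    (hM : IsLayerSpace ρ (permRep G Y) M) {N : Submodule ℝ ((Y → ℝ) →ᵃ[ℝ] ℝ)}
    (hN : IsLayerSpace (permRep G Y) (Representation.trivial ℝ G ℝ) N) {y : Y}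
    (hM_orbit : ∀ ξ ∈ linearPart M, orbitProj G y ∘ₗ ξ ∈ linearPart M)
    (hN_orbit : ∃ ψ ∈ linearPart N, ψ ((MulAction.orbit G y).indicator 1) ≠ 0)
    {s : Finset Y} (hs : ↑s = MulAction.orbit G y) {φ : Fin m → (V →ₗ[ℝ] (Y → ℝ))}
    (hφ : Submodule.span ℝ (range φ) = linearPart M) {β : Y → C(V, Fin m → ℝ)}
    (hβ : ∀ i x, β i x = basisMap φ i x) (f : C(Fin m → ℝ, ℝ)) :
    superposition s β f ∈ (networks σ M N).topologicalClosure := by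
  obtain ⟨ψ, hψ, hψy⟩ := hN_orbit
  have htop : (networks σ M N).topologicalClosure.comap (superposition s β).toLinearMap = ⊤ := by
    refine eq_top_of_forall_ridge_mem (σ := ⟨σ, hσ⟩)
      ((Submodule.isClosed_topologicalClosure _).preimage (superposition s β).continuous)
      hσ_poly fun ℓ b => Submodule.le_topologicalClosure _ ?_
    have hξ : LinearMap.pi (fun i => ℓ.toLinearMap ∘ₗ basisMap φ i) ∈ linearPart M :=
      hφ ▸ mem_span_range_iff_exists_dual.mpr ⟨ℓ, fun _ _ => rfl⟩
    exact sum_orbit_mem_networks hM hN hψ hψy hs (hM_orbit _ hξ) b fun x => by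
      simp [superposition, hβ]
  exact (htop ▸ Submodule.mem_top :
    f ∈ (networks σ M N).topologicalClosure.comap (superposition s β).toLinearMap)

variable [Fintype Y]

/- The separating maps let a single outer function simulate one function per label; the values at
`0` that it picks up along the way are compensated by spreading a constant over `Y`. -/
lemma mem_symmetricSuperpositions_of_labelling [Nonempty Y] {φ : Y → (V →ₗ[ℝ] (Fin m → ℝ))}
    {ι : Type*} [Finite ι] {label : Y → ι} {P : ι → ((Fin m → ℝ) →ₗ[ℝ] (Fin m → ℝ))}
    (hP : ∀ i x, P (label i) (φ i x) = φ i x) (hP' : ∀ o i x, label i ≠ o → P o (φ i x) = 0)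
    (H : ι → C(Fin m → ℝ, ℝ)) (C : ℝ) {F : C(V, ℝ)}
    (hF : ∀ x, F x = ∑ i, H (label i) (φ i x) + C) : F ∈ symmetricSuperpositions φ := by
  have := Fintype.ofFinite ι
  have hPc (o : ι) : Continuous (P o) := (P o).continuous_of_finiteDimensional
  refine ⟨⟨fun z => ∑ o, (H o (P o z) - H o 0) + (∑ i, H (label i) 0 + C) / Fintype.card Y,
    by fun_prop⟩, fun x => ?_⟩
  have hsum (i : Y) : ∑ o, (H o (P o (φ i x)) - H o 0) = H (label i) (φ i x) - H (label i) 0 := by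
    rw [Finset.sum_eq_single (label i), hP]
    · intro o _ ho
      rw [hP' o i x ho.symm, sub_self]
    · simp
  simp only [ContinuousMap.coe_mk, hsum]
  rw [hF, Finset.sum_add_distrib, Finset.sum_sub_distrib, Finset.sum_const, Finset.card_univ,
    nsmul_eq_mul]
  rw [mul_div_cancel₀ _ (Nat.cast_ne_zero.mpr Fintype.card_ne_zero)]
  ring

theorem networks_subset_symmetricSuperpositions [Nonempty Y] {G : Type*} [Group G] [MulAction G Y]
    {σ : ℝ → ℝ} (hσ : Continuous σ) {ρ : Representation ℝ G V}
    {M : Submodule ℝ (V →ᵃ[ℝ] (Y → ℝ))} (hM : IsLayerSpace ρ (permRep G Y) M)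
    {N : Submodule ℝ ((Y → ℝ) →ᵃ[ℝ] ℝ)}
    (hN : IsLayerSpace (permRep G Y) (Representation.trivial ℝ G ℝ) N)
    {φ : Fin m → (V →ₗ[ℝ] (Y → ℝ))} (hφ : Submodule.span ℝ (range φ) = linearPart M)
    (hφ_orbit : ∀ t (y : Y), orbitProj G y ∘ₗ φ t ∈ Submodule.span ℝ (range φ)) :
    (networks σ M N : Set C(V, ℝ)) ⊆ symmetricSuperpositions (basisMap φ) := by
  rintro F ⟨h, hF⟩
  obtain ⟨f, g, hf, hg, hF⟩ := mem_neuralSpace_widen.mp hF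
  have := Fintype.ofFinite (MulAction.orbitRel.Quotient G Y)
  obtain ⟨P, hP, hP'⟩ := exists_orbit_separation hφ_orbit
  choose ℓ w hfℓ using fun k => hM.exists_eq_dual_add hφ (hf k)
  choose d hgd using fun k => hN.exists_eq_sum_add (hg k)
  have hℓ (k : Fin h) : Continuous (ℓ k) := (ℓ k).continuous_of_finiteDimensional
  refine mem_symmetricSuperpositions_of_labelling hP hP'
    (fun o => ⟨fun z => ∑ k, d k o * σ (ℓ k z + w k o), by fun_prop⟩) (∑ k, g k 0) fun x => ?_
  calc F x = ∑ k, (∑ i, d k (orbitOf G i) * pointwise σ (f k x) i + g k 0) :=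
        (hF x).trans (Finset.sum_congr rfl fun k _ => hgd k _)
    _ = ∑ i, ∑ k, d k (orbitOf G i) * σ (ℓ k (basisMap φ i x) + w k (orbitOf G i)) +
        ∑ k, g k 0 := by
      rw [Finset.sum_add_distrib, Finset.sum_comm]
      simp only [pointwise, hfℓ]

theorem symmetricSuperpositions_subset_closure_networks {G : Type*} [Group G] [MulAction G Y]
    {σ : ℝ → ℝ} (hσ : Continuous σ) (hσ_poly : ¬ ∃ p : Polynomial ℝ, ∀ t, σ t = p.eval t)
    {ρ : Representation ℝ G V} {M : Submodule ℝ (V →ᵃ[ℝ] (Y → ℝ))}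
    (hM : IsLayerSpace ρ (permRep G Y) M)
    (hM_orbit : ∀ φ ∈ linearPart M, ∀ y : Y, orbitProj G y ∘ₗ φ ∈ linearPart M)
    {N : Submodule ℝ ((Y → ℝ) →ᵃ[ℝ] ℝ)}
    (hN : IsLayerSpace (permRep G Y) (Representation.trivial ℝ G ℝ) N)
    (hN_orbit : ∀ y : Y, ∃ ψ ∈ linearPart N, ψ ((MulAction.orbit G y).indicator 1) ≠ 0)
    {φ : Fin m → (V →ₗ[ℝ] (Y → ℝ))} (hφ : Submodule.span ℝ (range φ) = linearPart M)
    (hφ_cont : ∀ t, Continuous (φ t)) :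
    symmetricSuperpositions (basisMap φ) ⊆ closure (networks σ M N : Set C(V, ℝ)) := by
  classical
  have := Fintype.ofFinite (MulAction.orbitRel.Quotient G Y)
  rintro F ⟨f, hF⟩
  let β (i : Y) : C(V, Fin m → ℝ) :=
    ⟨basisMap φ i, continuous_pi fun t => (continuous_apply i).comp (hφ_cont t)⟩
  have hsum : F = ∑ o, superposition {i | orbitOf G i = o} β f := by
    ext x
    simp only [hF, superposition, ContinuousLinearMap.coe_mk', LinearMap.coe_mk, AddHom.coe_mk,
      Finset.sum_fiberwise, ContinuousMap.sum_apply]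
    rfl
  rw [hsum]
  refine (networks σ M N).topologicalClosure.sum_mem fun o _ => ?_
  induction o using Quotient.inductionOn with
  | h y =>
    refine superposition_orbit_mem_closure_networks hσ hσ_poly hM hN (y := y)
      (fun ξ hξ => hM_orbit ξ hξ y) (hN_orbit y) ?_ hφ (fun _ _ => rfl) f
    ext i
    simp [mem_orbit_iff_orbitOf_eq]

lemma span_range_coe_basis {ι R E : Type*} [Ring R] [AddCommGroup E] [Module R E]
    {p : Submodule R E} (b : Module.Basis ι R p) :
    Submodule.span R (range fun t => (b t : E)) = p := by
  rw [range_comp' Subtype.val b, ← Submodule.coe_subtype, Submodule.span_image, b.span_eq,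
    Submodule.map_subtype_top]

end superpositions

end InvNet

theorem mainTheorem7_general {G V Y : Type*} [Group G] [AddCommGroup V] [Module ℝ V]
    [TopologicalSpace V] [Fintype Y] [Nonempty Y] [MulAction G Y]
    (σ : ℝ → ℝ) (hσ : Continuous σ) (hσ_poly : ¬ ∃ p : Polynomial ℝ, ∀ t, σ t = p.eval t)
    (ρ : Representation ℝ G V) (M : Submodule ℝ (V →ᵃ[ℝ] (Y → ℝ)))
    (hM : InvNet.IsLayerSpace ρ (InvNet.permRep G Y) M)
    (hM_orbit : ∀ φ ∈ InvNet.linearPart M, ∀ y : Y,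
      InvNet.orbitProj G y ∘ₗ φ ∈ InvNet.linearPart M)
    (N : Submodule ℝ ((Y → ℝ) →ᵃ[ℝ] ℝ))
    (hN : InvNet.IsLayerSpace (InvNet.permRep G Y) (Representation.trivial ℝ G ℝ) N)
    (hN_orbit : ∀ y : Y, ∃ ψ ∈ InvNet.linearPart N, ψ ((MulAction.orbit G y).indicator 1) ≠ 0)
    {m : ℕ} (φ : Fin m → (V →ₗ[ℝ] (Y → ℝ)))
    (hφ : Submodule.span ℝ (Set.range φ) = InvNet.linearPart M) (hφ_cont : ∀ t, Continuous (φ t)) :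
    InvNet.universalityClass σ M N =
      closure (InvNet.symmetricSuperpositions (InvNet.basisMap φ)) := by
  have hφ_mem (t : Fin m) : φ t ∈ InvNet.linearPart M := hφ ▸ Submodule.subset_span ⟨t, rfl⟩
  refine Set.Subset.antisymm (closure_mono ?_) (closure_minimal ?_ isClosed_closure)
  · exact InvNet.networks_subset_symmetricSuperpositions hσ hM hN hφ fun t y =>
      hφ ▸ hM_orbit _ (hφ_mem t) y
  · exact InvNet.symmetricSuperpositions_subset_closure_networks hσ hσ_poly hM hM_orbit hN hN_orbit
      hφ hφ_cont

theorem mainTheorem7 {G X Y : Type*} [Group G] [Finite G] [Fintype X] [Fintype Y] [Nonempty Y]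
    [MulAction G X] [MulAction G Y]
    (σ : ℝ → ℝ) (hσ : Continuous σ) (hσ_poly : ¬ ∃ p : Polynomial ℝ, ∀ t, σ t = p.eval t)
    (M : Submodule ℝ ((X → ℝ) →ᵃ[ℝ] (Y → ℝ)))
    (hM : InvNet.IsLayerSpace (InvNet.permRep G X) (InvNet.permRep G Y) M)
    (hM_orbit : ∀ φ ∈ InvNet.linearPart M, ∀ y : Y,
      InvNet.orbitProj G y ∘ₗ φ ∈ InvNet.linearPart M)
    (N : Submodule ℝ ((Y → ℝ) →ᵃ[ℝ] ℝ))
    (hN : InvNet.IsLayerSpace (InvNet.permRep G Y) (Representation.trivial ℝ G ℝ) N)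
    (hN_orbit : ∀ y : Y, ∃ ψ ∈ InvNet.linearPart N, ψ ((MulAction.orbit G y).indicator 1) ≠ 0)
    {m : ℕ} (φ : Module.Basis (Fin m) ℝ (InvNet.linearPart M)) :
    InvNet.universalityClass σ M N =
      closure (InvNet.symmetricSuperpositions
        (InvNet.basisMap fun t => (φ t : (X → ℝ) →ₗ[ℝ] (Y → ℝ)))) :=
  mainTheorem7_general σ hσ hσ_poly _ M hM hM_orbit N hN hN_orbit _
    (InvNet.span_range_coe_basis φ) fun _ => LinearMap.continuous_of_finiteDimensional _
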